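/- Let $n\in\mathbb{N}$, let $N_1,\dots,N_n\ge 1$ be integers, $N=\sum_i N_i$, and write $x\in\mathbb{R}^N$ as $x=(x_1,\dots,x_n)$ with $x_i\in\mathbb{R}^{N_i}$; let $|\cdot|$ denote an arbitrary fixed norm on each $\mathbb{R}^{N_i}$. Let $\mathbb{R}_+=[0,\infty)$. For $1\le i,j\le n$ let $\gamma_{ij}:\mathbb{R}_+\to\mathbb{R}_+$ be either identically zero or of class $\mathscr{K}$ (continuous, strictly increasing, $\gamma_{ij}(0)=0$), and let $\gamma_{ii}\equiv 0$ for all $i$. Define $\Gamma:\mathbb{R}^n_+\to\mathbb{R}^n_+$ by $\Gamma(s)_i=\sum_{j=1}^n\gamma_{ij}(s_j)$ and $$\Omega_i=\Big\{x\in\mathbb{R}^N:\ |x_i|>\sum_{j\ne i}\gamma_{ij}(|x_j|)\Big\},\qquad i=1,\dots,n.$$ For vectors, $a\ge b$ means $a_i\ge b_i$ for all $i$, and $a>b$ means $a_i>b_i$ for all $i$. Then the condition $$\Gamma(s)\not\ge s\quad\text{for all } s\in\mathbb{R}^n_+\setminus\{0\}$$ is equivalent to $$\bigcup_{i=1}^n\Omega_i=\mathbb{R}^N\setminus\{0\}\quad\text{and}\quad\bigcap_{i=1}^n\Omega_i\ne\emptyset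 .$$ In particular, under this condition there is $s\in\mathbb{R}^n_+$ with $s>0$ and $s>\Gamma(s)$. -/

import Mathlib

open scoped NNReal

namespace GainNetwork

/-- Class `𝒦`: continuous, (strictly) increasing functions `ℝ₊ → ℝ₊` vanishing at `0`. -/
structure IsClassK (g : ℝ≥0 → ℝ≥0) : Prop where
  continuous : Continuous g
  strictMono : StrictMono g
  map_zero : g 0 = 0

/-- A matrix of gains: every entry is of class `𝒦` or identically zero, and the diagonal
entries are identically zero. -/
structure IsGainMatrix {n : ℕ} (γ : Fin n → Fin n → ℝ≥0 → ℝ≥0) : Prop where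
  classK_or_zero : ∀ i j, IsClassK (γ i j) ∨ γ i j = 0
  diag_zero : ∀ i, γ i i = 0

/-- The (nonlinear) gain operator `Γ : ℝ₊ⁿ → ℝ₊ⁿ`, `Γ(s)_i = ∑_j γ_ij(s_j)`. -/
def gainMap {n : ℕ} (γ : Fin n → Fin n → ℝ≥0 → ℝ≥0) (s : Fin n → ℝ≥0) : Fin n → ℝ≥0 :=
  fun i => ∑ j, γ i j (s j)

/-- `Γ(s) ≱ s` for all `s ∈ ℝ₊ⁿ \ {0}`, where `≥` is the componentwise order. -/
def SmallGain {n : ℕ} (γ : Fin n → Fin n → ℝ≥0 → ℝ≥0) : Prop :=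
  ∀ s : Fin n → ℝ≥0, s ≠ 0 → ¬ (gainMap γ s ≥ s)

/-- `ℝ^N`, `N = ∑ N_i`, partitioned into the blocks `x_i ∈ ℝ^{N_i}`. -/
abbrev StateSpace {n : ℕ} (N : Fin n → ℕ) : Type :=
  ∀ i : Fin n, Fin (N i) → ℝ

/-- The norm `|x_i|` of the `i`-th block, as an element of `ℝ₊`. -/
def blockNorm {n : ℕ} {N : Fin n → ℕ} (ν : ∀ i, Seminorm ℝ (Fin (N i) → ℝ))
    (x : StateSpace N) (i : Fin n) : ℝ≥0 :=
  ⟨ν i (x i), apply_nonneg (ν i) (x i)⟩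

/-- `Ω_i = {x ∈ ℝ^N : |x_i| > ∑_{j ≠ i} γ_ij(|x_j|)}`. -/
def Omega {n : ℕ} {N : Fin n → ℕ} (ν : ∀ i, Seminorm ℝ (Fin (N i) → ℝ))
    (γ : Fin n → Fin n → ℝ≥0 → ℝ≥0) (i : Fin n) : Set (StateSpace N) :=
  {x | blockNorm ν x i > ∑ j ∈ Finset.univ.erase i, γ i j (blockNorm ν x j)}

end GainNetwork

namespace GainNetwork

variable {n : ℕ} {γ : Fin n → Fin n → ℝ≥0 → ℝ≥0}

/-! Every `s ≥ 0` is the vector of block norms of some `x`, so the covering condition is just the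
small gain condition. The content is a point with `Γ(s) < s`. For small `δ > 0`, take a fixed point
of the monotone map `s ↦ min (Γ(s) + δ) 1`: a uniform form of small gain rules out truncation, so `s
= Γ(s) + δ`. -/

theorem IsGainMatrix.continuous (hγ : IsGainMatrix γ) (i j : Fin n) : Continuous (γ i j) := by
  rcases hγ.classK_or_zero i j with h | h
  · exact h.continuous
  · rw [h]; exact continuous_const

theorem IsGainMatrix.monotone (hγ : IsGainMatrix γ) (i j : Fin n) : Monotone (γ i j) := by
  rcases hγ.classK_or_zero i j with h | h
  · exact h.strictMono.monotone
  · rw [h]; exact monotone_const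

theorem continuous_gainMap (hγ : IsGainMatrix γ) : Continuous (gainMap γ) :=
  continuous_pi fun i => continuous_finsetSum _ fun j _ =>
    (hγ.continuous i j).comp (continuous_apply j)

theorem monotone_gainMap (hγ : IsGainMatrix γ) : Monotone (gainMap γ) :=
  fun _ _ h i => Finset.sum_le_sum fun j _ => hγ.monotone i j (h j)

theorem sum_erase_eq_gainMap (hγ : IsGainMatrix γ) (s : Fin n → ℝ≥0) (i : Fin n) :
    ∑ j ∈ Finset.univ.erase i, γ i j (s j) = gainMap γ s i :=
  Finset.sum_erase _ (by rw [hγ.diag_zero i]; rfl)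

theorem mem_Omega_iff (hγ : IsGainMatrix γ) {N : Fin n → ℕ}
    (ν : ∀ i, Seminorm ℝ (Fin (N i) → ℝ)) (i : Fin n) (x : StateSpace N) :
    x ∈ Omega ν γ i ↔ gainMap γ (blockNorm ν x) i < blockNorm ν x i := by
  rw [← sum_erase_eq_gainMap hγ]; rfl

/-- A monotone continuous self-map of the order interval `[0, 1]` in `ℝ₊ⁿ` has a fixed point. -/
theorem exists_fixedPoint_of_monotone {T : (Fin n → ℝ≥0) → (Fin n → ℝ≥0)} (hc : Continuous T)
    (hm : Monotone T) (h1 : ∀ s, T s ≤ 1) : ∃ s, T s = s := by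
  have hK : IsCompact {s : Fin n → ℝ≥0 | s ≤ T s} := by
    refine (isCompact_Icc (a := (0 : Fin n → ℝ≥0)) (b := 1)).of_isClosed_subset
      (isClosed_le continuous_id hc) fun s hs => ⟨zero_le, le_trans hs (h1 s)⟩
  -- `T` preserves `{s ≤ T s}`, so at a maximiser of the coordinate sum `T s ≥ s` cannot be strict.
  obtain ⟨s, hs, hmax⟩ := hK.exists_isMaxOn ⟨0, (zero_le : 0 ≤ T 0)⟩
    (f := fun s : Fin n → ℝ≥0 => ∑ i, s i) (by fun_prop)
  have hs' : s ≤ T s := hs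
  have hle : ∑ i, T s i ≤ ∑ i, s i := hmax (show T s ≤ T (T s) from hm hs')
  have heq := (Finset.sum_eq_sum_iff_of_le fun i _ => hs' i).1
    (le_antisymm (Finset.sum_le_sum fun i _ => hs' i) hle)
  exact ⟨s, funext fun i => (heq i (Finset.mem_univ i)).symm⟩

/-- On the part of `[0, 1]` where some coordinate equals `1`, the small gain condition is
uniform. -/
theorem SmallGain.exists_uniform_gap (h : SmallGain γ) (hγ : IsGainMatrix γ) :
    ∃ δ : ℝ≥0, 0 < δ ∧ ∀ s : Fin n → ℝ≥0, s ≤ 1 → (∃ i, s i = 1) →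
      ∃ i, gainMap γ s i + δ < s i := by
  have hcl : IsClosed {s : Fin n → ℝ≥0 | ∃ i, s i = 1} := by
    rw [Set.ofPred_exists]
    exact isClosed_iUnion_of_finite fun i => isClosed_eq (continuous_apply i) continuous_const
  have hK := (isCompact_Icc (a := (0 : Fin n → ℝ≥0)) (b := 1)).inter_right hcl
  have hΓ := continuous_gainMap hγ
  have hf : Continuous fun s : Fin n → ℝ≥0 => ∑ i, (s i - gainMap γ s i) :=
    continuous_finsetSum _ fun i _ =>
      (continuous_apply i).sub ((continuous_apply i).comp hΓ)
  obtain ⟨a, ha, hle⟩ := hK.exists_forall_le' hf.continuousOn (a := 0) (by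
    rintro s ⟨-, k, hk⟩
    have hne : s ≠ 0 := by rintro rfl; simp at hk
    obtain ⟨i, hi⟩ : ∃ i, gainMap γ s i < s i := by
      by_contra! hcon
      exact h s hne hcon
    exact Finset.sum_pos' (fun _ _ => zero_le) ⟨i, Finset.mem_univ i, tsub_pos_of_lt hi⟩)
  -- If all `n` gaps were at most `a / (n + 1)`, their sum would be below its lower bound `a`; `n +
  -- 1` also covers `n = 0`.
  refine ⟨a / (n + 1), by positivity, fun s hs hex => ?_⟩
  by_contra! hcon
  have h1 : a ≤ n * (a / (n + 1)) := by
    refine (hle s ⟨⟨zero_le, hs⟩, hex⟩).trans ?_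
    calc ∑ i, (s i - gainMap γ s i) ≤ ∑ _i : Fin n, a / (n + 1) :=
          Finset.sum_le_sum fun i _ => tsub_le_iff_left.2 (hcon i)
      _ = n * (a / (n + 1)) := by simp
  have h2 : (n + 1) * (a / (n + 1)) = a := mul_div_cancel₀ _ (by positivity)
  have h3 : 0 < a / (n + 1) := by positivity
  rw [add_mul, one_mul] at h2
  exact absurd h1 (not_le.2 (by conv_rhs => rw [← h2]
                                exact lt_add_of_pos_right _ h3))

/-- Under the small gain condition, `Γ + δ` truncated at `1` has a fixed point for small `δ`, and
this fixed point is strictly decreased by `Γ`. -/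
theorem SmallGain.exists_gainMap_lt (h : SmallGain γ) (hγ : IsGainMatrix γ) :
    ∃ s : Fin n → ℝ≥0, (∀ i, 0 < s i) ∧ ∀ i, gainMap γ s i < s i := by
  obtain ⟨δ, hδ, hgap⟩ := h.exists_uniform_gap hγ
  have hΓ := continuous_gainMap hγ
  obtain ⟨s, hs⟩ := exists_fixedPoint_of_monotone
    (T := fun s i => min (gainMap γ s i + δ) 1)
    (continuous_pi fun i =>
      (((continuous_apply i).comp hΓ).add continuous_const).min continuous_const)
    (fun s t hst i => min_le_min_right _ (add_le_add_left (monotone_gainMap hγ hst i) δ))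
    (fun s i => min_le_right _ _)
  have hs' (i : Fin n) : min (gainMap γ s i + δ) 1 = s i := congrFun hs i
  have hlt (i : Fin n) : gainMap γ s i < s i := by
    rcases min_choice (gainMap γ s i + δ) 1 with hi | hi
    · rw [← hs' i, hi]
      exact lt_add_of_pos_right _ hδ
    -- Truncation puts `s` where the gap applies, against `s ≤ Γ(s) + δ`.
    · obtain ⟨k, hk⟩ := hgap s (fun j => hs' j ▸ min_le_right _ _) ⟨i, by rw [← hs' i, hi]⟩
      exact absurd (hs' k ▸ min_le_left _ _) hk.not_ge
  exact ⟨s, fun i => zero_le.trans_lt (hlt i), hlt⟩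

theorem exists_blockNorm_eq {N : Fin n → ℕ} (hN : ∀ i, 1 ≤ N i)
    (ν : ∀ i, Seminorm ℝ (Fin (N i) → ℝ)) (hν : ∀ i v, ν i v = 0 → v = 0) (s : Fin n → ℝ≥0) :
    ∃ x : StateSpace N, blockNorm ν x = s := by
  -- Rescale the all-ones vector, nonzero since `N i ≥ 1`.
  refine ⟨fun i => ((s i : ℝ) / ν i 1) • 1, funext fun i => NNReal.eq ?_⟩
  have hne : ν i 1 ≠ 0 := fun h0 => by
    simpa using congrFun (hν i 1 h0) ⟨0, hN i⟩
  have hnn : 0 ≤ (s i : ℝ) / ν i 1 := div_nonneg (s i).2 (apply_nonneg _ _)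
  change ν i (((s i : ℝ) / ν i 1) • 1) = s i
  rw [map_smul_eq_mul, Real.norm_of_nonneg hnn, div_mul_cancel₀ _ hne]

theorem blockNorm_eq_zero_iff {N : Fin n → ℕ} (ν : ∀ i, Seminorm ℝ (Fin (N i) → ℝ))
    (hν : ∀ i v, ν i v = 0 → v = 0) (x : StateSpace N) : blockNorm ν x = 0 ↔ x = 0 := by
  constructor
  · intro h
    exact funext fun i => hν i _ (congrArg NNReal.toReal (congrFun h i))
  · rintro rfl
    exact funext fun i => NNReal.eq (map_zero (ν i))

theorem smallGain_iff_iUnion_Omega (hγ : IsGainMatrix γ) {N : Fin n → ℕ} (hN : ∀ i, 1 ≤ N i)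
    (ν : ∀ i, Seminorm ℝ (Fin (N i) → ℝ)) (hν : ∀ i v, ν i v = 0 → v = 0) :
    SmallGain γ ↔ (⋃ i, Omega ν γ i) = (Set.univ \ {0} : Set (StateSpace N)) := by
  constructor
  · intro h
    ext x
    simp only [Set.mem_iUnion, mem_Omega_iff hγ, Set.mem_sdiff, Set.mem_univ, true_and,
      Set.mem_singleton_iff]
    rw [← blockNorm_eq_zero_iff ν hν]
    constructor
    · rintro ⟨i, hi⟩ h0
      rw [h0] at hi
      exact not_lt_zero hi
    · intro hx
      by_contra! hcon
      exact h _ hx hcon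
  · intro h s hs hge
    obtain ⟨x, rfl⟩ := exists_blockNorm_eq hN ν hν s
    have hx : x ∈ ⋃ i, Omega ν γ i := by
      rw [h]
      exact ⟨Set.mem_univ x, fun h0 => hs ((blockNorm_eq_zero_iff ν hν x).2 h0)⟩
    obtain ⟨i, hi⟩ := Set.mem_iUnion.1 hx
    exact absurd (hge i) ((mem_Omega_iff hγ ν i x).1 hi).not_ge

end GainNetwork

theorem mainTheorem6 {n : ℕ} (N : Fin n → ℕ) (hN : ∀ i, 1 ≤ N i)
    (ν : ∀ i, Seminorm ℝ (Fin (N i) → ℝ)) (hν : ∀ i v, ν i v = 0 → v = 0)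
    (γ : Fin n → Fin n → ℝ≥0 → ℝ≥0) (hγ : GainNetwork.IsGainMatrix γ) :
    (GainNetwork.SmallGain γ ↔
      (⋃ i, GainNetwork.Omega ν γ i) = (Set.univ \ {0} : Set (GainNetwork.StateSpace N)) ∧
        (⋂ i, GainNetwork.Omega ν γ i).Nonempty) ∧
    (GainNetwork.SmallGain γ →
      ∃ s : Fin n → ℝ≥0, (∀ i, 0 < s i) ∧ ∀ i, s i > GainNetwork.gainMap γ s i) := by
  have hU := GainNetwork.smallGain_iff_iUnion_Omega hγ hN ν hν
  refine ⟨⟨fun h => ⟨hU.1 h, ?_⟩, fun h => hU.2 h.1⟩, fun h => h.exists_gainMap_lt hγ⟩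
  obtain ⟨s, -, hs⟩ := h.exists_gainMap_lt hγ
  obtain ⟨x, rfl⟩ := GainNetwork.exists_blockNorm_eq hN ν hν s
  exact ⟨x, Set.mem_iInter.2 fun i => (GainNetwork.mem_Omega_iff hγ ν i x).2 (hs i)⟩
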